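/- Let $\sigma$ be a subsequence of the sequence $e\,w_l\,w_r\,c$ in which $w_l$ occurs. Then each of the varieties $\mathring{\mathbb M}_\sigma^{sl}$, $\mathring{\mathbb M}_\sigma^{\ell}$, $\mathbb{PM}_\sigma^{sl}$ and $\mathbb{PM}_\sigma^{\ell}$ has the finite embeddability property. Here an sl-monoid is an algebra $\langle A,\vee,*,1\rangle$ such that $\langle A,\vee\rangle$ is a join-semilattice, $\langle A,*,1\rangle$ is a monoid, and $*$ distributes over $\vee$ on both sides; an $\ell$-monoid is an algebra $\langle A,\vee,\wedge,*,1\rangle$ such that $\langle A,\vee,\wedge\rangle$ is a lattice and $\langle A,\vee,*,1\rangle$ is an sl-monoid. In both cases $x\le y$ means $x\vee y=y$. A pointed sl-monoid (pointed $\ell$-monoid) has in addition a constant $0$, interpreted as an arbitrary element. A pseudocomplemented sl-monoid ($\ell$-monoid) is a pointed one with two further unary basic operations $a\mapsto a^{\backslash}$ (right negation) and $a\mapsto{}'a$ (left negation) such that, for all $a,b$, $$a*b\le 0\iff b\le a^{\backslash}\iff a\le{}'b .$$ The letters of $\sigma$ stand for the following properties, required for all $x,y,z,t$: $e$: if $x*y\le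 z$ then $y*x\le z$ (commutativity); $w_l$: if $x*y\le z$ then $x*t*y\le z$ (integrality, $x\le 1$); $w_r$: if $x\le 0$ then $x\le y$ ($0$ is the least element); $c$: if $x*x\le y$ then $x\le y$ ($x\le x*x$). Then $\mathring{\mathbb M}_\sigma^{sl}$, $\mathring{\mathbb M}_\sigma^{\ell}$, $\mathbb{PM}_\sigma^{sl}$ and $\mathbb{PM}_\sigma^{\ell}$ are the classes of pointed sl-monoids, pointed $\ell$-monoids, pseudocomplemented sl-monoids and pseudocomplemented $\ell$-monoids, respectively, that have the properties of all letters of $\sigma$. A class $\mathbb K$ of algebras of the same type has the finite embeddability property if for every $\mathbf A\in\mathbb K$ and every finite subset $B$ of $A$ there are a finite $\mathbf D\in\mathbb K$ and an injective map $h:B\to D$ such that $h(f^{\mathbf A}(b_1,\dots,b_n))=f^{\mathbf D}(h(b_1),\dots,h(b_n))$ for every basic operation $f$ (constants included) and all $b_1,\dots,b_n\in B$ with $f^{\mathbf A}(b_1,\dots,b_n)\in B$. -/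

import Mathlib

universe u

open FirstOrder

namespace FLFragments

/-! ### Algebras, partial subalgebras and the finite embeddability property

An algebraic language is a first-order language without relation symbols, and an algebra is a
structure of such a language. -/

/-- The value of a constant symbol. -/
def cst {L : Language} {A : Type u} [L.Structure A] (f : L.Functions 0) : A :=
  Language.Structure.funMap f ![]

/-- The unary operation named by a unary symbol. -/
def un {L : Language} {A : Type u} [L.Structure A] (f : L.Functions 1) (x : A) : A :=
  Language.Structure.funMap f ![x]

/-- The binary operation named by a binary symbol. -/
def bin {L : Language} {A : Type u} [L.Structure A] (f : L.Functions 2) (x y : A) : A :=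
  Language.Structure.funMap f ![x, y]

/-- Every subset `B` of an algebra `A` carries a partial subalgebra: a basic operation `f` is
defined at a tuple of elements of `B` exactly when its value in `A` lies in `B`, and it then has
that value. The map `h` embeds this partial subalgebra into the algebra `D` if it is injective
and preserves every basic operation (constants included) wherever it is defined in `B`. -/
def IsPartialEmbedding (L : Language) {A D : Type u} [L.Structure A] [L.Structure D]
    (B : Set A) (h : B → D) : Prop :=
  Function.Injective h ∧
    ∀ (n : ℕ) (f : L.Functions n) (x : Fin n → B) (b : B),
      Language.Structure.funMap f (fun i => (x i : A)) = (b : A) →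
        Language.Structure.funMap f (fun i => h (x i)) = h b

/-- The finite embeddability property of a class `K` of algebras: every finite partial
subalgebra of a member of `K` embeds into a finite member of `K`. -/
def HasFEP (L : Language) (K : ∀ (A : Type u) [L.Structure A], Prop) : Prop :=
  ∀ (A : Type u) [L.Structure A], K A → ∀ B : Set A, B.Finite →
    ∃ (D : Type u) (_ : L.Structure D), Finite D ∧ K D ∧ ∃ h : B → D, IsPartialEmbedding L B h

/-! ### The four languages -/

/-- The symbols of the language `⟨∨, *, 0, 1⟩`. -/
inductive SlSym : ℕ → Type
  | join : SlSym 2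
  | mul : SlSym 2
  | zero : SlSym 0
  | one : SlSym 0

/-- The symbols of the language `⟨∨, ∧, *, 0, 1⟩`. -/
inductive LatSym : ℕ → Type
  | join : LatSym 2
  | meet : LatSym 2
  | mul : LatSym 2
  | zero : LatSym 0
  | one : LatSym 0

/-- The symbols of the language `⟨∨, *, rneg, lneg, 0, 1⟩`, with a right negation `rneg` and a left
negation `lneg`. -/
inductive PSlSym : ℕ → Type
  | join : PSlSym 2
  | mul : PSlSym 2
  | rneg : PSlSym 1
  | lneg : PSlSym 1
  | zero : PSlSym 0
  | one : PSlSym 0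

/-- The symbols of the language `⟨∨, ∧, *, rneg, lneg, 0, 1⟩`, with a right negation `rneg` and a left
negation `lneg`. -/
inductive PLatSym : ℕ → Type
  | join : PLatSym 2
  | meet : PLatSym 2
  | mul : PLatSym 2
  | rneg : PLatSym 1
  | lneg : PLatSym 1
  | zero : PLatSym 0
  | one : PLatSym 0

/-- The algebraic language `⟨∨, *, 0, 1⟩`. -/
abbrev slLang : Language := ⟨SlSym, fun _ => Empty⟩

/-- The algebraic language `⟨∨, ∧, *, 0, 1⟩`. -/
abbrev latLang : Language := ⟨LatSym, fun _ => Empty⟩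

/-- The algebraic language `⟨∨, *, rneg, lneg, 0, 1⟩`. -/
abbrev pslLang : Language := ⟨PSlSym, fun _ => Empty⟩

/-- The algebraic language `⟨∨, ∧, *, rneg, lneg, 0, 1⟩`. -/
abbrev platLang : Language := ⟨PLatSym, fun _ => Empty⟩

/-! ### Semilattice monoids, lattice monoids, pseudocomplements -/

section Laws

variable {A : Type u}

/-- `⟨A, ∨, *, 1⟩` is a semilattice monoid. -/
structure IsSlMonoid (join mul : A → A → A) (one : A) : Prop where
  join_idem : ∀ x, join x x = x
  join_comm : ∀ x y, join x y = join y x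
  join_assoc : ∀ x y z, join (join x y) z = join x (join y z)
  mul_assoc : ∀ x y z, mul (mul x y) z = mul x (mul y z)
  one_mul : ∀ x, mul one x = x
  mul_one : ∀ x, mul x one = x
  join_mul : ∀ x y z, mul (join x y) z = join (mul x z) (mul y z)
  mul_join : ∀ x y z, mul z (join x y) = join (mul z x) (mul z y)

/-- `⟨A, ∨, ∧, *, 1⟩` is a lattice monoid. -/
structure IsLatMonoid (join meet mul : A → A → A) (one : A) : Prop
    extends IsSlMonoid join mul one where
  meet_idem : ∀ x, meet x x = x
  meet_comm : ∀ x y, meet x y = meet y x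
  meet_assoc : ∀ x y z, meet (meet x y) z = meet x (meet y z)
  join_meet_self : ∀ x y, join x (meet x y) = x
  meet_join_self : ∀ x y, meet x (join x y) = x

/-- The order of the join-semilattice. -/
def Le (join : A → A → A) (x y : A) : Prop := join x y = y

/-- The law of pseudocomplementation:
`a * b ≤ 0` iff `b ≤ rneg a` iff `a ≤ lneg b`. -/
def IsPseudocompl (join mul : A → A → A) (rneg lneg : A → A) (zero : A) : Prop :=
  ∀ a b, (Le join (mul a b) zero ↔ Le join b (rneg a)) ∧
    (Le join (mul a b) zero ↔ Le join a (lneg b))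

end Laws

/-! ### The structural properties -/

/-- The letters `e`, `w_l`, `w_r`, `c`. -/
inductive Letter : Type
  | e | wl | wr | c

/-- The sequence `e w_l w_r c`. -/
def allLetters : List Letter := [Letter.e, Letter.wl, Letter.wr, Letter.c]

/-- The property codified by a letter: exchange, left weakening, right weakening, contraction. -/
def Letter.Holds {A : Type u} (join mul : A → A → A) (zero : A) : Letter → Prop
  | .e => ∀ x y z, Le join (mul x y) z → Le join (mul y x) z
  | .wl => ∀ x y z t, Le join (mul x y) z → Le join (mul (mul x t) y) z
  | .wr => ∀ x y, Le join x zero → Le join x y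
  | .c => ∀ x y, Le join (mul x x) y → Le join x y

/-! ### The four classes of algebras -/

/-- The class of pointed semilattice monoids with the properties codified by `σ`. -/
def PointedSl (σ : List Letter) (A : Type u) [slLang.Structure A] : Prop :=
  IsSlMonoid (bin (L := slLang) (A := A) SlSym.join) (bin (L := slLang) SlSym.mul)
      (cst (L := slLang) SlSym.one) ∧
    ∀ r ∈ σ, r.Holds (bin (L := slLang) (A := A) SlSym.join) (bin (L := slLang) SlSym.mul)
      (cst (L := slLang) SlSym.zero)

/-- The class of pointed lattice monoids with the properties codified by `σ`. -/
def PointedLat (σ : List Letter) (A : Type u) [latLang.Structure A] : Prop :=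
  IsLatMonoid (bin (L := latLang) (A := A) LatSym.join) (bin (L := latLang) LatSym.meet)
      (bin (L := latLang) LatSym.mul) (cst (L := latLang) LatSym.one) ∧
    ∀ r ∈ σ, r.Holds (bin (L := latLang) (A := A) LatSym.join) (bin (L := latLang) LatSym.mul)
      (cst (L := latLang) LatSym.zero)

/-- The class of pseudocomplemented semilattice monoids with the properties codified by `σ`. -/
def PseudoSl (σ : List Letter) (A : Type u) [pslLang.Structure A] : Prop :=
  IsSlMonoid (bin (L := pslLang) (A := A) PSlSym.join) (bin (L := pslLang) PSlSym.mul)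
      (cst (L := pslLang) PSlSym.one) ∧
    IsPseudocompl (bin (L := pslLang) (A := A) PSlSym.join) (bin (L := pslLang) PSlSym.mul)
      (un (L := pslLang) PSlSym.rneg) (un (L := pslLang) PSlSym.lneg)
      (cst (L := pslLang) PSlSym.zero) ∧
    ∀ r ∈ σ, r.Holds (bin (L := pslLang) (A := A) PSlSym.join) (bin (L := pslLang) PSlSym.mul)
      (cst (L := pslLang) PSlSym.zero)

/-- The class of pseudocomplemented lattice monoids with the properties codified by `σ`. -/
def PseudoLat (σ : List Letter) (A : Type u) [platLang.Structure A] : Prop :=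
  IsLatMonoid (bin (L := platLang) (A := A) PLatSym.join) (bin (L := platLang) PLatSym.meet)
      (bin (L := platLang) PLatSym.mul) (cst (L := platLang) PLatSym.one) ∧
    IsPseudocompl (bin (L := platLang) (A := A) PLatSym.join) (bin (L := platLang) PLatSym.mul)
      (un (L := platLang) PLatSym.rneg) (un (L := platLang) PLatSym.lneg)
      (cst (L := platLang) PLatSym.zero) ∧
    ∀ r ∈ σ, r.Holds (bin (L := platLang) (A := A) PLatSym.join)
      (bin (L := platLang) PLatSym.mul) (cst (L := platLang) PLatSym.zero)

end FLFragments

/-!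
The proof is a completion by residuated frames, with finiteness supplied by Higman's lemma.

Let `A` be a pointed semilattice monoid in which `1` is the greatest element (this is what the
letter `wl` says), let `B ⊆ A` be finite and contain `0`, and let `M` be the submonoid of
`A` generated by `B`. Each `b ∈ B` determines the down-set `P b = {m ∈ M | m ≤ b}`. Let `D` consist
of all intersections of the sets `{x ∈ M | u * x * v ∈ P b}` with `u, v ∈ M` and `b ∈ B`. In other
words, `D` is the concept lattice of the relation `u * x * v ≤ b` between elements `x` and contexts
`(u, b, v)`. Contexts are closed under multiplication on either side, so the complex product of `M`
followed by closure makes `D` a residuated lattice (`ContextAlgebra`). Its residuals into `P 0` are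
the two negations, and no residuals or meets are needed in `A`. The letters pass from `A` to `D`,
and `b ↦ P b` preserves every operation where it is defined in `B`: for joins this is where
distributivity in `A` is used, and the other operations follow from `P b` being the closed set
generated by `b` (`exists_finite_completion_of_order`).

`D` is finite because every element of `M` is a product of a word over the finite set `B`, and
by integrality a word lies below each of its subwords. Higman's lemma thus makes the dual of the
order of `M` a well-quasi-order (`wellQuasiOrdered_closure`). For fixed `b` the sets
`{x | u * x * v ∈ P b}` are down-sets that depend antitonically on `(u, v)`; an infinite family of
them would contain a strictly ascending sequence, which the well-quasi-order forbids
(`finite_range_of_antitone`). So there are only finitely many basic closed sets.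

The single algebra `D` carries all the operations at once, and its reducts serve the four classes.
-/

namespace FLFragments

open Order Concept
open scoped Pointwise

/-! ### Finiteness from well-quasi-orders -/

/-- If the duals of `C` and `M` are well-quasi-ordered, an antitone family of down-sets of `M`
indexed by `C` has only finitely many members. -/
theorem finite_range_of_antitone {C M : Type*} [Preorder C] [Preorder M]
    (hC : WellQuasiOrdered fun a b : C => b ≤ a) (hM : WellQuasiOrdered fun a b : M => b ≤ a)
    (f : C → Set M) (hf : Antitone f) (hlow : ∀ c, IsLowerSet (f c)) : (Set.range f).Finite := by
  by_contra hinf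
  have hinf : (Set.range f).Infinite := hinf
  have : IsPreorder C fun a b => b ≤ a :=
    { refl := fun a => le_refl a, trans := fun a b c h h' => le_trans h' h }
  choose c hc using fun n => (hinf.natEmbedding _ n).2
  obtain ⟨k, hk⟩ := hC.exists_monotone_subseq c
  have hmono : ∀ m n, m ≤ n → f (c (k m)) ⊆ f (c (k n)) := fun m n h => hf (hk m n h)
  -- Along `k` the sets increase strictly; pick an element that is new at each step.
  have hne : ∀ n, ∃ x ∈ f (c (k (n + 1))), x ∉ f (c (k n)) := by
    intro n
    by_contra! h
    have heq : f (c (k n)) = f (c (k (n + 1))) :=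
      Set.Subset.antisymm (hmono _ _ n.le_succ) h
    rw [hc, hc] at heq
    have := k.injective ((hinf.natEmbedding _).injective (Subtype.ext heq))
    omega
  choose x hx hx' using hne
  obtain ⟨m, n, hmn, hle⟩ := hM x
  exact hx' n (hlow _ hle (hmono _ _ (Nat.succ_le_of_lt hmn) (hx m)))

/-- In an integral ordered monoid, a finitely generated submonoid is dually well-quasi-ordered:
deleting letters from a word makes its product larger, so Higman's lemma applies. -/
theorem wellQuasiOrdered_closure {A : Type*} [Monoid A] [Preorder A] [MulLeftMono A]
    [MulRightMono A] (hint : ∀ x : A, x ≤ 1) {B : Set A} (hB : B.Finite) :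
    WellQuasiOrdered fun a b : Submonoid.closure B => b ≤ a := by
  have hprod : ∀ l₁ l₂ : List A, List.SublistForall₂ (· = ·) l₁ l₂ → l₂.prod ≤ l₁.prod := by
    intro l₁ l₂ h
    induction h with
    | nil => exact hint _
    | cons h _ ih => subst h; simpa using mul_le_mul_right ih _
    | cons_right _ ih =>
      rw [List.prod_cons]
      exact (mul_le_of_le_one_left' (hint _)).trans ih
  have hpwo := (hB.partiallyWellOrderedOn (r := (· = ·))).partiallyWellOrderedOn_sublistForall₂
    (· = ·)
  intro s
  choose l hl hls using fun n => Submonoid.exists_list_of_mem_closure (s n).2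
  obtain ⟨m, n, hmn, h⟩ := hpwo.exists_lt (f := l) hl
  refine ⟨m, n, hmn, ?_⟩
  have := hprod _ _ h
  rwa [hls, hls] at this

/-! ### The residuated lattice of closed sets -/

section ContextAlgebra

variable {M ι : Type*} [Monoid M] {P : ι → Set M}

/-- The element `x` satisfies the context `(u, i, v)` if `u * x * v ∈ P i`. -/
abbrev InContext (P : ι → Set M) (x : M) (t : M × ι × M) : Prop :=
  t.1 * x * t.2.2 ∈ P t.2.1

/-- The lattice of closed subsets of `M`, those of the form `{x | ∀ t ∈ T, InContext P x t}` for
a set `T` of contexts. It is encoded as the concept lattice of `InContext P`; the closed set is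
the extent of the concept, and the order is inclusion of extents. -/
abbrev ContextAlgebra (P : ι → Set M) : Type _ := Concept M (M × ι × M) (InContext P)

namespace ContextAlgebra

theorem mem_extent_iff {Z : ContextAlgebra P} {x : M} :
    x ∈ Z.extent ↔ ∀ t ∈ Z.intent, t.1 * x * t.2.2 ∈ P t.2.1 := by
  rw [← Z.lowerPolar_intent]
  rfl

/-- The greatest closed set `Y` with `S * Y ⊆ Z`. It is closed because `u * (x * y) * v` is
`(u * x) * y * v`, so that contexts for `x * y` are contexts for `y`. -/
def rightResidual (S : Set M) (Z : ContextAlgebra P) : ContextAlgebra P :=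
  ofIsExtent _ {y | ∀ x ∈ S, x * y ∈ Z.extent} <| by
    refine ⟨{t | ∃ x ∈ S, ∃ s ∈ Z.intent, t = (s.1 * x, s.2)}, ?_⟩
    ext y
    constructor
    · intro h x hx
      rw [mem_extent_iff]
      intro s hs
      simpa only [InContext, mul_assoc] using h ⟨x, hx, s, hs, rfl⟩
    · rintro h _ ⟨x, hx, s, hs, rfl⟩
      simpa only [InContext, mul_assoc] using mem_extent_iff.1 (h x hx) s hs

/-- The greatest closed set `X` with `X * S ⊆ Z`. -/
def leftResidual (S : Set M) (Z : ContextAlgebra P) : ContextAlgebra P :=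
  ofIsExtent _ {x | ∀ y ∈ S, x * y ∈ Z.extent} <| by
    refine ⟨{t | ∃ y ∈ S, ∃ s ∈ Z.intent, t = (s.1, s.2.1, y * s.2.2)}, ?_⟩
    ext x
    constructor
    · intro h y hy
      rw [mem_extent_iff]
      intro s hs
      simpa only [InContext, mul_assoc] using h ⟨y, hy, s, hs, rfl⟩
    · rintro h _ ⟨y, hy, s, hs, rfl⟩
      simpa only [InContext, mul_assoc] using mem_extent_iff.1 (h y hy) s hs

/-- The product of closed sets is the closure of their complex product. -/
instance : Mul (ContextAlgebra P) := ⟨fun X Y => ofObjects _ (X.extent * Y.extent)⟩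

/-- The unit is the closure of `{1}`. -/
instance : One (ContextAlgebra P) := ⟨ofObjects _ 1⟩

theorem mul_le_iff {X Y Z : ContextAlgebra P} :
    X * Y ≤ Z ↔ ∀ x ∈ X.extent, ∀ y ∈ Y.extent, x * y ∈ Z.extent :=
  ofObjects_le_iff.trans Set.mul_subset_iff

theorem mul_le_iff_le_rightResidual {X Y Z : ContextAlgebra P} :
    X * Y ≤ Z ↔ Y ≤ rightResidual X.extent Z :=
  mul_le_iff.trans ⟨fun h y hy x hx => h x hx y hy, fun h x hx _ hy => h hy x hx⟩

theorem mul_le_iff_le_leftResidual {X Y Z : ContextAlgebra P} :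
    X * Y ≤ Z ↔ X ≤ leftResidual Y.extent Z :=
  mul_le_iff

/-- Closure is a nucleus: closing the factors first does not change the closure of a product.
Associativity and the unit laws are inherited from sets through this identity. -/
theorem ofObjects_mul_ofObjects (S T : Set M) :
    (ofObjects (InContext P) S * ofObjects _ T : ContextAlgebra P) = ofObjects _ (S * T) := by
  refine eq_of_forall_ge_iff fun Z => ?_
  rw [ofObjects_le_iff, Set.mul_subset_iff, mul_le_iff_le_leftResidual, ofObjects_le_iff]
  change (∀ x ∈ S, ∀ y ∈ _, _) ↔ _
  refine forall₂_congr fun x _ => ?_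
  have h := ofObjects_le_iff (r := InContext P) (s := T) (c := rightResidual {x} Z)
  simpa [← extent_subset_extent_iff, Set.subset_def, rightResidual] using h

theorem mul_eq (X Y : ContextAlgebra P) : X * Y = ofObjects _ (X.extent * Y.extent) := rfl

instance : Monoid (ContextAlgebra P) where
  mul_assoc X Y Z := by
    calc X * Y * Z = ofObjects _ (X.extent * Y.extent) * ofObjects _ Z.extent := by
          rw [ofObjects_extent, mul_eq X Y]
      _ = ofObjects _ X.extent * ofObjects _ (Y.extent * Z.extent) := by
          rw [ofObjects_mul_ofObjects, ofObjects_mul_ofObjects, mul_assoc]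
      _ = X * (Y * Z) := by rw [ofObjects_extent, mul_eq Y Z]
  one_mul X := by
    conv_lhs => rw [← ofObjects_extent (c := X)]
    exact (ofObjects_mul_ofObjects _ _).trans (by rw [one_mul, ofObjects_extent])
  mul_one X := by
    conv_lhs => rw [← ofObjects_extent (c := X)]
    exact (ofObjects_mul_ofObjects _ _).trans (by rw [mul_one, ofObjects_extent])

theorem isLatMonoid (P : ι → Set M) :
    IsLatMonoid (A := ContextAlgebra P) (· ⊔ ·) (· ⊓ ·) (· * ·) 1 where
  join_idem := sup_idem
  join_comm := sup_comm
  join_assoc := sup_assoc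
  mul_assoc := mul_assoc
  one_mul := one_mul
  mul_one := mul_one
  join_mul X Y Z := eq_of_forall_ge_iff fun W => by
    simp only [sup_le_iff, mul_le_iff_le_leftResidual]
  mul_join X Y Z := eq_of_forall_ge_iff fun W => by
    simp only [sup_le_iff, mul_le_iff_le_rightResidual]
  meet_idem := inf_idem
  meet_comm := inf_comm
  meet_assoc := inf_assoc
  join_meet_self X Y := sup_inf_self
  meet_join_self X Y := inf_sup_self

theorem isPseudocompl (Z : ContextAlgebra P) :
    IsPseudocompl (A := ContextAlgebra P) (· ⊔ ·) (· * ·) (fun X => rightResidual X.extent Z)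
      (fun X => leftResidual X.extent Z) Z := fun X Y => by
  simp only [Le, sup_eq_right]
  exact ⟨mul_le_iff_le_rightResidual, mul_le_iff_le_leftResidual⟩

theorem finite [Finite ι] [Preorder M] [MulLeftMono M] [MulRightMono M]
    (hM : WellQuasiOrdered fun a b : M => b ≤ a) (hP : ∀ i, IsLowerSet (P i)) :
    Finite (ContextAlgebra P) := by
  have hpre : IsPreorder M fun a b => b ≤ a :=
    { refl := fun a => le_refl a, trans := fun a b c h h' => le_trans h' h }
  let g : M × ι × M → Set M := fun t => {x | InContext P x t}
  have hg : (Set.range g).Finite := by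
    have hi : ∀ i, (Set.range fun c : M × M => g (c.1, i, c.2)).Finite := fun i => by
      refine finite_range_of_antitone (hM.prod hM) hM _ ?_ ?_
      · exact fun c d h x hx => hP i (mul_le_mul' (mul_le_mul_left h.1 x) h.2) hx
      · exact fun c x y h hx => hP i (mul_le_mul_left (mul_le_mul_right h _) _) hx
    refine (Set.finite_iUnion hi).subset ?_
    rintro _ ⟨⟨u, i, v⟩, rfl⟩
    exact Set.mem_iUnion.2 ⟨i, (u, v), rfl⟩
  have hfin : (Set.sInter '' (𝒫 Set.range g)).Finite := hg.powerset.image _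
  have : Finite (Set.sInter '' (𝒫 Set.range g)) := hfin
  refine Finite.of_injective (β := Set.sInter '' (𝒫 Set.range g))
    (fun X => ⟨X.extent, g '' X.intent, Set.image_subset_range _ _, ?_⟩)
    fun X Y h => Concept.ext (congrArg Subtype.val h)
  ext x
  simp [g, mem_extent_iff]

end ContextAlgebra

end ContextAlgebra

/-! ### The completion of a finite partial subalgebra -/

/-- The algebra `D` is a pseudocomplemented lattice monoid with every structural property of `A`,
and `e : B → D` is injective and preserves each operation where its value in `A` lies in `B`.
As `A` need not have meets or negations, an element `c` of `B` counts as the value of such an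
operation when it has the universal property of that value. -/
structure IsCompletion {A D : Type*} (join mul : A → A → A) (one zero : A) (B : Set A)
    (joinD meetD mulD : D → D → D) (rnegD lnegD : D → D) (oneD zeroD : D) (e : B → D) :
    Prop where
  isLatMonoid : IsLatMonoid joinD meetD mulD oneD
  isPseudocompl : IsPseudocompl joinD mulD rnegD lnegD zeroD
  holds : ∀ r : Letter, r.Holds join mul zero → r.Holds joinD mulD zeroD
  injective : Function.Injective e
  join_eq : ∀ a b c : B, join a b = c → joinD (e a) (e b) = e c
  meet_eq : ∀ a b c : B, (∀ x, Le join x c ↔ Le join x a ∧ Le join x b) →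
    meetD (e a) (e b) = e c
  mul_eq : ∀ a b c : B, mul a b = c → mulD (e a) (e b) = e c
  rneg_eq : ∀ a c : B, (∀ x, Le join (mul a x) zero ↔ Le join x c) → rnegD (e a) = e c
  lneg_eq : ∀ a c : B, (∀ x, Le join (mul x a) zero ↔ Le join x c) → lnegD (e a) = e c
  one_eq : ∀ a : B, one = a → oneD = e a
  zero_eq : ∀ a : B, zero = a → zeroD = e a

open ContextAlgebra in
/-- Existence of a finite completion, for an integral semilattice monoid given by typeclasses. The
element `0` is taken to lie in `B`, since the closed set `P 0` has to interpret `0` in `D`. -/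
theorem exists_finite_completion_of_order {A : Type u} [SemilatticeSup A] [Monoid A]
    (hjm : ∀ x y z : A, (x ⊔ y) * z = x * z ⊔ y * z)
    (hmj : ∀ x y z : A, z * (x ⊔ y) = z * x ⊔ z * y) (hint : ∀ x : A, x ≤ 1) (zero : A)
    {B : Set A} (hB : B.Finite) (hzero : zero ∈ B) :
    ∃ (D : Type u) (joinD meetD mulD : D → D → D) (rnegD lnegD : D → D) (oneD zeroD : D)
      (e : B → D), Finite D ∧
        IsCompletion (· ⊔ ·) (· * ·) (1 : A) zero B joinD meetD mulD rnegD lnegD oneD zeroD e := by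
  have : MulLeftMono A := ⟨fun z x y h => by
    rw [← sup_eq_right, ← hmj, sup_eq_right.2 h]⟩
  have : MulRightMono A := ⟨fun z x y h => by
    change x * z ≤ y * z
    rw [← sup_eq_right, ← hjm, sup_eq_right.2 h]⟩
  have : MulLeftMono (Submonoid.closure B) :=
    ⟨fun z x y h => mul_le_mul_right (α := A) h z⟩
  have : MulRightMono (Submonoid.closure B) :=
    ⟨fun z x y h => mul_le_mul_left (α := A) h z⟩
  have : Finite B := hB
  let P : B → Set (Submonoid.closure B) := fun b => {m | (m : A) ≤ b}
  let g : B → Submonoid.closure B := fun b => ⟨b, Submonoid.subset_closure b.2⟩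
  let e : B → ContextAlgebra P := fun b => ofAttribute _ (1, b, 1)
  have he : ∀ (b : B) (m : Submonoid.closure B), m ∈ (e b).extent ↔ (m : A) ≤ b := fun b m => by
    simp [e, P]
  have hmem : ∀ (Z : ContextAlgebra P) (m : Submonoid.closure B),
      m ∈ Z.extent ↔ ∀ t ∈ Z.intent, (t.1 * m * t.2.2 : A) ≤ t.2.1 := fun _ _ => mem_extent_iff
  have hlow : ∀ Z : ContextAlgebra P, IsLowerSet Z.extent := fun Z x y h hx => by
    rw [hmem] at hx ⊢
    have h' : (y : A) ≤ x := h
    exact fun t ht => (mul_le_mul_left (mul_le_mul_right h' _) _).trans (hx t ht)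
  -- `e b` is the least closed set containing `b`.
  have hle : ∀ (b : B) (Z : ContextAlgebra P), e b ≤ Z ↔ g b ∈ Z.extent := fun b Z =>
    ⟨fun h => h ((he b (g b)).2 le_rfl), fun h m hm => hlow Z ((he b m).1 hm) h⟩
  refine ⟨ContextAlgebra P, (· ⊔ ·), (· ⊓ ·), (· * ·),
    fun X => rightResidual X.extent (e ⟨zero, hzero⟩),
    fun X => leftResidual X.extent (e ⟨zero, hzero⟩), 1, e ⟨zero, hzero⟩, e,
    ContextAlgebra.finite (wellQuasiOrdered_closure hint hB) fun b x y h hx => le_trans h hx,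
    ?_⟩
  refine
    { isLatMonoid := ContextAlgebra.isLatMonoid P
      isPseudocompl := ContextAlgebra.isPseudocompl _
      holds := ?_
      injective := fun a b h => Subtype.ext <| le_antisymm ((he b (g a)).1 ?_)
        ((he a (g b)).1 ?_)
      join_eq := fun a b c h => eq_of_forall_ge_iff fun Z => ?_
      meet_eq := fun a b c h => Concept.ext <| Set.ext fun m => ?_
      mul_eq := fun a b c h => eq_of_forall_ge_iff fun Z => ?_
      rneg_eq := fun a c h => Concept.ext <| Set.ext fun m => ?_
      lneg_eq := fun a c h => Concept.ext <| Set.ext fun m => ?_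
      one_eq := fun a h => eq_of_forall_ge_iff fun Z => ?_
      zero_eq := fun a h => congrArg e (Subtype.ext h) }
  · rintro (_ | _ | _ | _) h
    · simp only [Letter.Holds, Le, sup_eq_right] at h ⊢
      intro X Y Z hXY
      rw [mul_le_iff] at hXY ⊢
      exact fun y hy x hx => hlow Z (h x y _ le_rfl : (y * x : A) ≤ x * y) (hXY x hx y hy)
    · simp only [Letter.Holds, Le, sup_eq_right] at h ⊢
      intro X Y Z T hXY
      rw [mul_le_iff_le_leftResidual] at hXY ⊢
      refine le_trans (mul_le_iff.2 fun x hx t _ => ?_) hXY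
      exact hlow X (mul_le_of_le_one_right' (hint t) : (x * t : A) ≤ x) hx
    · simp only [Letter.Holds, Le, sup_eq_right] at h ⊢
      refine fun X Y hX => hX.trans ((hle _ Y).2 ((hmem _ _).2 fun t _ => h _ _ ?_))
      exact (mul_le_of_le_one_right' (hint _)).trans (mul_le_of_le_one_left' (hint _))
    · simp only [Letter.Holds, Le, sup_eq_right] at h ⊢
      refine fun X Y hX x hx => hlow Y (a := x * x) ?_ (mul_le_iff.1 hX x hx x hx)
      exact (h x _ le_rfl : (x : A) ≤ x * x)
  · exact h ▸ (he a (g a)).2 le_rfl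
  · exact h.symm ▸ (he b (g b)).2 le_rfl
  -- A context that accepts `a` and `b` accepts `a ⊔ b`, by distributivity.
  · rw [sup_le_iff, hle, hle, hle, hmem, hmem, hmem, ← forall₂_and]
    refine forall₂_congr fun t _ => ?_
    rw [← sup_le_iff, ← hjm, ← hmj]
    simp [g, ← h]
  · simp only [Le, sup_eq_right] at h
    simp [he, h]
  · rw [mul_le_iff, hle]
    have : g c = g a * g b := Subtype.ext h.symm
    rw [this]
    refine ⟨fun H => H _ ((he a _).2 le_rfl) _ ((he b _).2 le_rfl), fun H x hx y hy => ?_⟩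
    exact hlow Z (mul_le_mul' ((he a x).1 hx) ((he b y).1 hy) : x * y ≤ g a * g b) H
  · simp only [Le, sup_eq_right] at h
    rw [he, ← h]
    refine ⟨fun H => (he _ _).1 (H (g a) ((he a _).2 le_rfl)), fun H x hx => (he _ _).2 ?_⟩
    exact (mul_le_mul_left ((he a x).1 hx) _).trans H
  · simp only [Le, sup_eq_right] at h
    rw [he, ← h]
    refine ⟨fun H => (he _ _).1 (H (g a) ((he a _).2 le_rfl)), fun H x hx => (he _ _).2 ?_⟩
    exact (mul_le_mul_right ((he a x).1 hx) _).trans H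
  · have : g a = 1 := Subtype.ext h.symm
    rw [hle, this]
    exact ofObjects_le_iff.trans Set.one_subset

/-- Every finite subset of an integral pointed semilattice monoid has a finite completion: apply
the construction to the subset enlarged by `0`, and restrict the embedding. -/
theorem exists_finite_completion {A : Type u} {join mul : A → A → A} {one : A}
    (hA : IsSlMonoid join mul one) (zero : A) (hwl : Letter.wl.Holds join mul zero)
    {B : Set A} (hB : B.Finite) :
    ∃ (D : Type u) (joinD meetD mulD : D → D → D) (rnegD lnegD : D → D) (oneD zeroD : D)
      (e : B → D), Finite D ∧
        IsCompletion join mul one zero B joinD meetD mulD rnegD lnegD oneD zeroD e := by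
  let _ : Max A := ⟨join⟩
  let _ : SemilatticeSup A := SemilatticeSup.mk' hA.join_comm hA.join_assoc hA.join_idem
  let _ : Monoid A :=
    { mul := mul, one := one, mul_assoc := hA.mul_assoc, one_mul := hA.one_mul,
      mul_one := hA.mul_one }
  have hint : ∀ x : A, x ≤ 1 := fun x => by
    have h : (1 * x * 1 : A) ≤ 1 := hwl one one one x (by
      rw [hA.one_mul]; exact hA.join_idem one)
    rwa [one_mul, mul_one] at h
  obtain ⟨D, joinD, meetD, mulD, rnegD, lnegD, oneD, zeroD, e, hD, he⟩ :=
    exists_finite_completion_of_order hA.join_mul hA.mul_join hint zero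
      (B := insert zero B) (hB.insert _) (Set.mem_insert _ _)
  have hsub : B ⊆ insert zero B := Set.subset_insert _ _
  refine ⟨D, joinD, meetD, mulD, rnegD, lnegD, oneD, zeroD, e ∘ Set.inclusion hsub, hD, ?_⟩
  exact
    { isLatMonoid := he.isLatMonoid
      isPseudocompl := he.isPseudocompl
      holds := he.holds
      injective := he.injective.comp (Set.inclusion_injective hsub)
      join_eq := fun _ _ _ h => he.join_eq _ _ _ h
      meet_eq := fun _ _ _ h => he.meet_eq _ _ _ h
      mul_eq := fun _ _ _ h => he.mul_eq _ _ _ h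
      rneg_eq := fun _ _ h => he.rneg_eq _ _ h
      lneg_eq := fun _ _ h => he.lneg_eq _ _ h
      one_eq := fun _ h => he.one_eq _ h
      zero_eq := fun _ h => he.zero_eq _ h }

/-! ### The four classes -/

section FunMap

variable {L : Language} {A : Type u} [L.Structure A]

theorem funMap_eq_cst (f : L.Functions 0) (x : Fin 0 → A) :
    Language.Structure.funMap f x = cst f :=
  congrArg _ (Subsingleton.elim _ _)

theorem funMap_eq_un (f : L.Functions 1) (x : Fin 1 → A) :
    Language.Structure.funMap f x = un f (x 0) :=
  congrArg _ (funext fun i => by fin_cases i; rfl)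

theorem funMap_eq_bin (f : L.Functions 2) (x : Fin 2 → A) :
    Language.Structure.funMap f x = bin f (x 0) (x 1) :=
  congrArg _ (funext fun i => by fin_cases i <;> rfl)

end FunMap

theorem IsLatMonoid.le_meet_iff {A : Type u} {join meet mul : A → A → A} {one : A}
    (h : IsLatMonoid join meet mul one) (a b x : A) :
    Le join x (meet a b) ↔ Le join x a ∧ Le join x b := by
  let _ : Max A := ⟨join⟩
  let _ : Min A := ⟨meet⟩
  let _ : Lattice A := Lattice.mk' h.join_comm h.join_assoc h.meet_comm h.meet_assoc
    h.join_meet_self h.meet_join_self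
  have : ∀ y z : A, Le join y z ↔ y ≤ z := fun y z => sup_eq_right
  rw [this, this, this]
  exact le_inf_iff

theorem hasFEP_pointedSl {σ : List Letter} (hwl : Letter.wl ∈ σ) :
    HasFEP.{u} slLang (fun A [_] => PointedSl σ A) := by
  intro A _ hA B hB
  obtain ⟨hM, hσ⟩ := hA
  obtain ⟨D, joinD, meetD, mulD, rnegD, lnegD, oneD, zeroD, e, hD, he⟩ :=
    exists_finite_completion hM (cst (L := slLang) SlSym.zero) (hσ _ hwl) hB
  let S : slLang.Structure D :=
    { funMap := fun {n} f => match n, f with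
        | _, .join => fun x => joinD (x 0) (x 1)
        | _, .mul => fun x => mulD (x 0) (x 1)
        | _, .zero => fun _ => zeroD
        | _, .one => fun _ => oneD
      RelMap := fun r => r.elim }
  refine ⟨D, S, hD, ⟨he.isLatMonoid.toIsSlMonoid, fun r hr => he.holds r (hσ r hr)⟩, e,
    he.injective, ?_⟩
  rintro _ (_ | _ | _ | _) x b h
  · exact he.join_eq _ _ _ ((funMap_eq_bin _ _).symm.trans h)
  · exact he.mul_eq _ _ _ ((funMap_eq_bin _ _).symm.trans h)
  · exact he.zero_eq _ ((funMap_eq_cst _ _).symm.trans h)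
  · exact he.one_eq _ ((funMap_eq_cst _ _).symm.trans h)

theorem hasFEP_pointedLat {σ : List Letter} (hwl : Letter.wl ∈ σ) :
    HasFEP.{u} latLang (fun A [_] => PointedLat σ A) := by
  intro A _ hA B hB
  obtain ⟨hM, hσ⟩ := hA
  obtain ⟨D, joinD, meetD, mulD, rnegD, lnegD, oneD, zeroD, e, hD, he⟩ :=
    exists_finite_completion hM.toIsSlMonoid (cst (L := latLang) LatSym.zero) (hσ _ hwl) hB
  let S : latLang.Structure D :=
    { funMap := fun {n} f => match n, f with
        | _, .join => fun x => joinD (x 0) (x 1)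
        | _, .meet => fun x => meetD (x 0) (x 1)
        | _, .mul => fun x => mulD (x 0) (x 1)
        | _, .zero => fun _ => zeroD
        | _, .one => fun _ => oneD
      RelMap := fun r => r.elim }
  refine ⟨D, S, hD, ⟨he.isLatMonoid, fun r hr => he.holds r (hσ r hr)⟩, e, he.injective, ?_⟩
  rintro _ (_ | _ | _ | _ | _) x b h
  · exact he.join_eq _ _ _ ((funMap_eq_bin _ _).symm.trans h)
  · refine he.meet_eq _ _ _ ?_
    rw [← h, funMap_eq_bin]
    exact hM.le_meet_iff _ _
  · exact he.mul_eq _ _ _ ((funMap_eq_bin _ _).symm.trans h)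
  · exact he.zero_eq _ ((funMap_eq_cst _ _).symm.trans h)
  · exact he.one_eq _ ((funMap_eq_cst _ _).symm.trans h)

theorem hasFEP_pseudoSl {σ : List Letter} (hwl : Letter.wl ∈ σ) :
    HasFEP.{u} pslLang (fun A [_] => PseudoSl σ A) := by
  intro A _ hA B hB
  obtain ⟨hM, hP, hσ⟩ := hA
  obtain ⟨D, joinD, meetD, mulD, rnegD, lnegD, oneD, zeroD, e, hD, he⟩ :=
    exists_finite_completion hM (cst (L := pslLang) PSlSym.zero) (hσ _ hwl) hB
  let S : pslLang.Structure D :=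
    { funMap := fun {n} f => match n, f with
        | _, .join => fun x => joinD (x 0) (x 1)
        | _, .mul => fun x => mulD (x 0) (x 1)
        | _, .rneg => fun x => rnegD (x 0)
        | _, .lneg => fun x => lnegD (x 0)
        | _, .zero => fun _ => zeroD
        | _, .one => fun _ => oneD
      RelMap := fun r => r.elim }
  refine ⟨D, S, hD, ⟨he.isLatMonoid.toIsSlMonoid, he.isPseudocompl,
    fun r hr => he.holds r (hσ r hr)⟩, e, he.injective, ?_⟩
  rintro _ (_ | _ | _ | _ | _ | _) x b h
  · exact he.join_eq _ _ _ ((funMap_eq_bin _ _).symm.trans h)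
  · exact he.mul_eq _ _ _ ((funMap_eq_bin _ _).symm.trans h)
  · refine he.rneg_eq _ _ ?_
    rw [← h, funMap_eq_un]
    exact fun y => (hP _ y).1
  · refine he.lneg_eq _ _ ?_
    rw [← h, funMap_eq_un]
    exact fun y => (hP y _).2
  · exact he.zero_eq _ ((funMap_eq_cst _ _).symm.trans h)
  · exact he.one_eq _ ((funMap_eq_cst _ _).symm.trans h)

theorem hasFEP_pseudoLat {σ : List Letter} (hwl : Letter.wl ∈ σ) :
    HasFEP.{u} platLang (fun A [_] => PseudoLat σ A) := by
  intro A _ hA B hB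
  obtain ⟨hM, hP, hσ⟩ := hA
  obtain ⟨D, joinD, meetD, mulD, rnegD, lnegD, oneD, zeroD, e, hD, he⟩ :=
    exists_finite_completion hM.toIsSlMonoid (cst (L := platLang) PLatSym.zero) (hσ _ hwl) hB
  let S : platLang.Structure D :=
    { funMap := fun {n} f => match n, f with
        | _, .join => fun x => joinD (x 0) (x 1)
        | _, .meet => fun x => meetD (x 0) (x 1)
        | _, .mul => fun x => mulD (x 0) (x 1)
        | _, .rneg => fun x => rnegD (x 0)
        | _, .lneg => fun x => lnegD (x 0)
        | _, .zero => fun _ => zeroD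
        | _, .one => fun _ => oneD
      RelMap := fun r => r.elim }
  refine ⟨D, S, hD, ⟨he.isLatMonoid, he.isPseudocompl, fun r hr => he.holds r (hσ r hr)⟩, e,
    he.injective, ?_⟩
  rintro _ (_ | _ | _ | _ | _ | _ | _) x b h
  · exact he.join_eq _ _ _ ((funMap_eq_bin _ _).symm.trans h)
  · refine he.meet_eq _ _ _ ?_
    rw [← h, funMap_eq_bin]
    exact hM.le_meet_iff _ _
  · exact he.mul_eq _ _ _ ((funMap_eq_bin _ _).symm.trans h)
  · refine he.rneg_eq _ _ ?_
    rw [← h, funMap_eq_un]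
    exact fun y => (hP _ y).1
  · refine he.lneg_eq _ _ ?_
    rw [← h, funMap_eq_un]
    exact fun y => (hP y _).2
  · exact he.zero_eq _ ((funMap_eq_cst _ _).symm.trans h)
  · exact he.one_eq _ ((funMap_eq_cst _ _).symm.trans h)

end FLFragments

theorem theorem32 (σ : List FLFragments.Letter)
    (hσ : σ.Sublist FLFragments.allLetters) (hwl : [FLFragments.Letter.wl].Sublist σ) :
    FLFragments.HasFEP.{u} FLFragments.slLang (fun A [_] => FLFragments.PointedSl σ A) ∧
    FLFragments.HasFEP.{u} FLFragments.latLang (fun A [_] => FLFragments.PointedLat σ A) ∧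
    FLFragments.HasFEP.{u} FLFragments.pslLang (fun A [_] => FLFragments.PseudoSl σ A) ∧
    FLFragments.HasFEP.{u} FLFragments.platLang (fun A [_] => FLFragments.PseudoLat σ A) := by
  have h := List.singleton_sublist.1 hwl
  exact ⟨FLFragments.hasFEP_pointedSl h, FLFragments.hasFEP_pointedLat h,
    FLFragments.hasFEP_pseudoSl h, FLFragments.hasFEP_pseudoLat h⟩
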